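/- Digraphs are finite, without loops or multiple arcs. Let $G$ be a strongly connected digraph with vertices $v_1,\dots,v_n$. Let $D(G)=(d_{ij})$ be its distance matrix, where $d_{ij}$ is the length of a shortest directed path from $v_i$ to $v_j$, let $\mathrm{Diag}(Tr)$ be the diagonal matrix with entries $\sum_{j} d_{ij}$ ($i=1,\dots,n$), and for $0\le\alpha\le 1$ let $\mu_\alpha(G)$ be the spectral radius (largest modulus of an eigenvalue) of $D_\alpha(G)=\alpha\,\mathrm{Diag}(Tr)+(1-\alpha)D(G)$. The vertex connectivity of $G$ is the minimum number of vertices whose removal leaves a digraph that is not strongly connected (and it is $n-1$ if $G$ is the complete digraph). For $1\le m\le n-k-1$ let $K(n,k,m)$ be the digraph of order $n$ whose vertex set is a disjoint union $S\cup A\cup B$ with $|S|=k$, $|A|=n-k-m$, $|B|=m$, and which has all arcs $(u,v)$ with $u\neq v$ except those from $A$ to $B$. **Theorem 4.5.** Let $n,k$ be integers with $1\le k\le n-2$ and let $G$ be a strongly connected digraph of order $n$ with vertex connectivity $k$. (i) For $\alpha=0$, $$\mu_0(G)\ \ge\ \frac{n-2+\sqrt{n^2+4n-4k-4}}{2},$$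 with equality if and only if $G\cong K(n,k,1)$ or $G\cong K(n,k,n-k-1)$. (ii) For $0<\alpha\le \frac45$, $$\mu_\alpha(G)\ \ge\ \mu_\alpha(K(n,k,1))=\frac{n-2+\alpha+\alpha n+\sqrt{(1-\alpha)^2n^2+(2\alpha^2-6\alpha+4)n+(\alpha^2+4\alpha-4)-4(1-\alpha)k}}{2},$$ with equality in the inequality if and only if $G\cong K(n,k,1)$. -/

import Mathlib

namespace Digraph

/-- A digraph is simple if it has no loops (multiple arcs are impossible here, since the arcs form
a relation). -/
def IsSimple {V : Type*} (G : Digraph V) : Prop :=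
  ∀ v : V, ¬ G.Adj v v

/-- `G.HasWalk l u v`: there is a directed walk with exactly `l` arcs from `u` to `v`. -/
def HasWalk {V : Type*} (G : Digraph V) : ℕ → V → V → Prop
  | 0, u, v => u = v
  | l + 1, u, v => ∃ w : V, G.Adj u w ∧ HasWalk G l w v

/-- Every vertex can be reached from every vertex. (There is a directed path from `u` to `v` if and
only if there is a directed walk.) -/
def IsStronglyConnected {V : Type*} (G : Digraph V) : Prop :=
  ∀ u v : V, ∃ l : ℕ, G.HasWalk l u v

/-- The distance from `u` to `v`: the length of a shortest directed path, equivalently of a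
shortest directed walk. Only used for strongly connected digraphs, where the set is nonempty. -/
noncomputable def dist {V : Type*} (G : Digraph V) (u v : V) : ℕ :=
  sInf {l : ℕ | G.HasWalk l u v}

/-- The digraph `G - S` obtained by removing the vertices in `S`. -/
def deleteVerts {V : Type*} (G : Digraph V) (S : Finset V) : Digraph {v : V // v ∉ S} where
  Adj u v := G.Adj u v

/-- The vertex connectivity: the least number of vertices whose removal leaves a digraph that is
not strongly connected or that has at most one vertex. (The second alternative is the usual
convention that gives the complete digraph of order `n` the connectivity `n - 1`; it does not matter
for the other digraphs.) -/
noncomputable def vertexConnectivity {V : Type*} [Fintype V] (G : Digraph V) : ℕ :=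
  sInf {c : ℕ | ∃ S : Finset V, S.card = c ∧
    (¬ (G.deleteVerts S).IsStronglyConnected ∨ Fintype.card V ≤ S.card + 1)}

/-- The distance matrix `D(G)`. -/
noncomputable def distMatrix {V : Type*} (G : Digraph V) : Matrix V V ℝ :=
  Matrix.of fun u v => (G.dist u v : ℝ)

/-- The transmission of a vertex: the sum of the distances from it to all vertices. -/
noncomputable def transmission {V : Type*} [Fintype V] (G : Digraph V) (u : V) : ℝ :=
  ∑ v : V, (G.dist u v : ℝ)

/-- The matrix `D_α(G) = α Diag(Tr) + (1 - α) D(G)`. -/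
noncomputable def alphaDistMatrix {V : Type*} [Fintype V] [DecidableEq V] (α : ℝ)
    (G : Digraph V) : Matrix V V ℝ :=
  α • Matrix.diagonal G.transmission + (1 - α) • G.distMatrix

/-- The `D_α` spectral radius `μ_α(G)`: the largest modulus of a complex eigenvalue of
`D_α(G)`. -/
noncomputable def alphaSpectralRadius {V : Type*} [Fintype V] [DecidableEq V] (α : ℝ)
    (G : Digraph V) : ℝ :=
  (spectralRadius ℂ ((G.alphaDistMatrix α).map (algebraMap ℝ ℂ))).toReal

/-- Isomorphism of digraphs: a bijection of the vertices that preserves and reflects arcs. -/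
def IsIsomorphic {V W : Type*} (G : Digraph V) (H : Digraph W) : Prop :=
  Nonempty (G.Adj ≃r H.Adj)

/-- The complete (loopless) digraph on `V`. -/
def simpleComplete (V : Type*) : Digraph V where
  Adj u v := u ≠ v

/-- The disjoint union of two digraphs. -/
def disjointUnion {V W : Type*} (G : Digraph V) (H : Digraph W) : Digraph (V ⊕ W) where
  Adj := fun
    | Sum.inl u, Sum.inl v => G.Adj u v
    | Sum.inr u, Sum.inr v => H.Adj u v
    | _, _ => False

/-- The join of two digraphs: their disjoint union together with all arcs, in both directions,
between the two parts. -/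
def join {V W : Type*} (G : Digraph V) (H : Digraph W) : Digraph (V ⊕ W) where
  Adj := fun
    | Sum.inl u, Sum.inl v => G.Adj u v
    | Sum.inr u, Sum.inr v => H.Adj u v
    | _, _ => True

/-- The arcs from each vertex of the third part to each vertex of the second part. -/
def thirdToSecond (U V W : Type*) : Digraph (U ⊕ (V ⊕ W)) where
  Adj := fun
    | Sum.inr (Sum.inr _), Sum.inr (Sum.inl _) => True
    | _, _ => False

/-- The digraph `K(n, k, m)`, the join of the complete digraph on `k` vertices with the disjoint
union of the complete digraphs on `n - k - m` and `m` vertices, with all arcs added from the part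
of size `m` to the part of size `n - k - m`. Meant for `1 ≤ m ≤ n - k - 1`. -/
def extremal (n k m : ℕ) : Digraph (Fin k ⊕ (Fin (n - k - m) ⊕ Fin m)) :=
  join (simpleComplete (Fin k))
      (disjointUnion (simpleComplete (Fin (n - k - m))) (simpleComplete (Fin m)))
    ⊔ thirdToSecond (Fin k) (Fin (n - k - m)) (Fin m)

end Digraph

/-! A minimum cut `S` of size `k` leaves two nonempty sets `A`, `B` with no arc from `A` to `B`.
Hence every distance in `G` is at least the one in the digraph having all other arcs, which is
`K(n,k,m)` with `m = |B|`: 0 on the diagonal, 2 from `A` to `B`, 1 elsewhere. That digraph has a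
positive eigenvector `w` constant on `A` and off `A`, with eigenvalue `c = αn - 1 + t`, where `t` is
the larger root of a quadratic. For `G` itself `D_α w ≥ c w`, so the Collatz–Wielandt bound gives
`μ_α(G) ≥ c`. Its strict form shows that equality forces equal distances, that is `G ≅ K(n,k,m)`
(`le_alphaSpectralRadius_and_isSplit`). It remains to minimize `t` over `m` with `|A| + m = n - k`
fixed (`splitRoot_one_le`): `m = 1` is optimal, tied only with `|A| = 1` when `α = 0`. -/

/-! ### Collatz–Wielandt bounds for nonnegative matrices -/

section PerronBounds

open Filter Topology

open scoped ENNReal NNReal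

namespace Matrix

variable {V : Type*} [Fintype V] [DecidableEq V]

/-- The spectral radius, over `ℂ`, of a real matrix. -/
noncomputable def realSpectralRadius (M : Matrix V V ℝ) : ℝ :=
  (spectralRadius ℂ (M.map (algebraMap ℝ ℂ))).toReal

/-- Needed because `toReal` sends `⊤` to 0. -/
theorem spectralRadius_map_ne_top (M : Matrix V V ℝ) :
    spectralRadius ℂ (M.map (algebraMap ℝ ℂ)) ≠ ⊤ := by
  let : NormedRing (Matrix V V ℂ) := Matrix.linftyOpNormedRing
  let : NormedAlgebra ℂ (Matrix V V ℂ) := Matrix.linftyOpNormedAlgebra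
  rcases isEmpty_or_nonempty V with h | h
  · have : Subsingleton (Matrix V V ℂ) := inferInstance
    simp [spectralRadius, spectrum.of_subsingleton]
  · exact ((spectrum.spectralRadius_le_nnnorm _).trans_lt ENNReal.coe_lt_top).ne

/-- Compare an eigenvector `v` with `x` at an index where `‖v i‖ / x i` is largest. -/
theorem norm_le_of_mem_spectrum {M : Matrix V V ℝ} (hM : ∀ i j, 0 ≤ M i j) {x : V → ℝ}
    (hx : ∀ i, 0 < x i) {c : ℝ} (h : ∀ i, (M *ᵥ x) i ≤ c * x i) {z : ℂ}
    (hz : z ∈ spectrum ℂ (M.map (algebraMap ℝ ℂ))) : ‖z‖ ≤ c := by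
  obtain ⟨v, hv0, hv⟩ : ∃ v : V → ℂ, v ≠ 0 ∧ (algebraMap ℂ (Matrix V V ℂ) z
      - M.map (algebraMap ℝ ℂ)) *ᵥ v = 0 := by
    rw [Matrix.exists_mulVec_eq_zero_iff]
    by_contra hdet
    exact hz ((Matrix.isUnit_iff_isUnit_det _).2 (isUnit_iff_ne_zero.2 hdet))
  obtain ⟨i₀, hi₀⟩ : ∃ i, v i ≠ 0 := by
    by_contra! hall
    exact hv0 (funext hall)
  have : Nonempty V := ⟨i₀⟩
  obtain ⟨i, hi⟩ := Finite.exists_max fun i => ‖v i‖ / x i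
  set r := ‖v i‖ / x i with hr
  have hrpos : 0 < r := (div_pos (norm_pos_iff.2 hi₀) (hx i₀)).trans_le (hi i₀)
  have hle (j : V) : ‖v j‖ ≤ r * x j := (div_le_iff₀ (hx j)).1 (hi j)
  have heq : ‖v i‖ = r * x i := by rw [hr, div_mul_cancel₀ _ (hx i).ne']
  have hvi : z * v i = ∑ j, (M i j : ℂ) * v j := by
    have := congrFun hv i
    rw [Matrix.sub_mulVec, Algebra.algebraMap_eq_smul_one, Matrix.smul_mulVec,
      Matrix.one_mulVec] at this
    simpa [Matrix.mulVec, dotProduct, sub_eq_zero] using this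
  have hb : ‖z‖ * (r * x i) ≤ c * (r * x i) := by
    calc ‖z‖ * (r * x i) = ‖∑ j, (M i j : ℂ) * v j‖ := by rw [← heq, ← norm_mul, hvi]
      _ ≤ ∑ j, M i j * (r * x j) := by
        refine (norm_sum_le _ _).trans (Finset.sum_le_sum fun j _ => ?_)
        rw [norm_mul, Complex.norm_real, Real.norm_of_nonneg (hM i j)]
        exact mul_le_mul_of_nonneg_left (hle j) (hM i j)
      _ = r * (M *ᵥ x) i := by
        simp only [Matrix.mulVec, dotProduct, Finset.mul_sum]
        exact Finset.sum_congr rfl fun j _ => by ring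
      _ ≤ r * (c * x i) := mul_le_mul_of_nonneg_left (h i) hrpos.le
      _ = c * (r * x i) := by ring
  exact le_of_mul_le_mul_right hb (mul_pos hrpos (hx i))

theorem realSpectralRadius_le [Nonempty V] {M : Matrix V V ℝ} (hM : ∀ i j, 0 ≤ M i j)
    {x : V → ℝ} (hx : ∀ i, 0 < x i) {c : ℝ} (h : ∀ i, (M *ᵥ x) i ≤ c * x i) :
    M.realSpectralRadius ≤ c := by
  have hc : 0 ≤ c := by
    obtain ⟨i⟩ := ‹Nonempty V›
    have : 0 ≤ (M *ᵥ x) i := Finset.sum_nonneg fun j _ => mul_nonneg (hM i j) (hx j).le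
    exact nonneg_of_mul_nonneg_left (this.trans (h i)) (hx i)
  refine ENNReal.toReal_le_of_le_ofReal hc (iSup₂_le fun z hz => ?_)
  rw [← enorm_eq_nnnorm, ← ofReal_norm]
  exact ENNReal.ofReal_le_ofReal (norm_le_of_mem_spectrum hM hx h hz)

theorem pow_mul_le_pow_mulVec {M : Matrix V V ℝ} (hM : ∀ i j, 0 ≤ M i j) {x : V → ℝ} {c : ℝ}
    (hc : 0 ≤ c) (h : ∀ i, c * x i ≤ (M *ᵥ x) i) (l : ℕ) (i : V) :
    c ^ l * x i ≤ (M ^ l *ᵥ x) i := by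
  induction l generalizing i with
  | zero => simp
  | succ l ih =>
    rw [pow_succ' M, ← Matrix.mulVec_mulVec]
    calc c ^ (l + 1) * x i = c ^ l * (c * x i) := by ring
      _ ≤ c ^ l * (M *ᵥ x) i := mul_le_mul_of_nonneg_left (h i) (pow_nonneg hc l)
      _ = ∑ j, M i j * (c ^ l * x j) := by
        simp only [Matrix.mulVec, dotProduct, Finset.mul_sum]
        exact Finset.sum_congr rfl fun j _ => by ring
      _ ≤ (M *ᵥ (M ^ l *ᵥ x)) i :=
        Finset.sum_le_sum fun j _ => mul_le_mul_of_nonneg_left (ih j) (hM i j)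

/-- Iterating gives `c ^ l * x ≤ M ^ l x`, hence `c ^ l ≤ ‖M ^ l‖` in the operator norm of the sup
norm; Gelfand's formula finishes. -/
theorem le_realSpectralRadius [Nonempty V] {M : Matrix V V ℝ} (hM : ∀ i j, 0 ≤ M i j)
    {x : V → ℝ} (hx : ∀ i, 0 < x i) {c : ℝ} (hc : 0 ≤ c) (h : ∀ i, c * x i ≤ (M *ᵥ x) i) :
    c ≤ M.realSpectralRadius := by
  let : NormedRing (Matrix V V ℂ) := Matrix.linftyOpNormedRing
  let : NormedAlgebra ℂ (Matrix V V ℂ) := Matrix.linftyOpNormedAlgebra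
  set A : Matrix V V ℂ := M.map (algebraMap ℝ ℂ) with hA
  have hpow (l : ℕ) : c ^ l ≤ ‖A ^ l‖ := by
    set y : V → ℂ := fun i => (x i : ℂ) with hy
    obtain ⟨i, hi⟩ := Finite.exists_max x
    have hynorm : ‖y‖ = x i := by
      refine le_antisymm ((pi_norm_le_iff_of_nonneg (hx i).le).2 fun j => ?_) ?_
      · rw [hy, Complex.norm_real, Real.norm_of_nonneg (hx j).le]
        exact hi j
      · calc x i = ‖y i‖ := by rw [hy, Complex.norm_real, Real.norm_of_nonneg (hx i).le]
          _ ≤ ‖y‖ := norm_le_pi_norm y i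
    have hAy : (A ^ l *ᵥ y) i = (((M ^ l *ᵥ x) i : ℝ) : ℂ) := by
      have : A ^ l = (M ^ l).map (algebraMap ℝ ℂ) :=
        ((algebraMap ℝ ℂ).mapMatrix.map_pow M l).symm
      rw [this]
      simp [Matrix.mulVec, dotProduct, hy]
    have h1 : c ^ l * x i ≤ ‖A ^ l‖ * x i := by
      calc c ^ l * x i ≤ (M ^ l *ᵥ x) i := pow_mul_le_pow_mulVec hM hc h l i
        _ ≤ ‖(A ^ l *ᵥ y) i‖ := by
          rw [hAy, Complex.norm_real]
          exact le_abs_self _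
        _ ≤ ‖A ^ l *ᵥ y‖ := norm_le_pi_norm _ i
        _ ≤ ‖A ^ l‖ * x i := hynorm ▸ Matrix.linfty_opNorm_mulVec (A ^ l) y
    exact le_of_mul_le_mul_right h1 (hx i)
  refine (ENNReal.ofReal_le_iff_le_toReal (spectralRadius_map_ne_top M)).1 ?_
  refine ge_of_tendsto (spectrum.pow_nnnorm_pow_one_div_tendsto_nhds_spectralRadius A) ?_
  filter_upwards [eventually_gt_atTop 0] with l hl
  have hl' : (l : ℝ) ≠ 0 := by positivity
  calc ENNReal.ofReal c = (ENNReal.ofReal c ^ (l : ℝ)) ^ (1 / l : ℝ) := by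
        rw [← ENNReal.rpow_mul, mul_one_div_cancel hl', ENNReal.rpow_one]
    _ ≤ (‖A ^ l‖₊ : ℝ≥0∞) ^ (1 / l : ℝ) := by
        refine ENNReal.rpow_le_rpow ?_ (by positivity)
        rw [ENNReal.rpow_natCast, ← ENNReal.ofReal_pow hc, ← enorm_eq_nnnorm, ← ofReal_norm]
        exact ENNReal.ofReal_le_ofReal (hpow l)

/-- The slack `w = Mx - cx` sits possibly at one index only. Replacing `x` by `z = (M + 1)x` turns
it into `(M + 1)w`, positive everywhere, so `c` can be raised by some `ε > 0`. The summand 1 covers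
a zero diagonal entry at `i₀`. -/
theorem lt_realSpectralRadius [Nonempty V] {M : Matrix V V ℝ} (hM : ∀ i j, 0 ≤ M i j)
    (hpos : ∀ i j, i ≠ j → 0 < M i j) {x : V → ℝ} (hx : ∀ i, 0 < x i) {c : ℝ} (hc : 0 ≤ c)
    (h : ∀ i, c * x i ≤ (M *ᵥ x) i) {i₀ : V} (hi₀ : c * x i₀ < (M *ᵥ x) i₀) :
    c < M.realSpectralRadius := by
  set w : V → ℝ := M *ᵥ x - c • x with hw
  have hw0 (i : V) : 0 ≤ w i := by simpa [hw] using h i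
  have hwpos : 0 < w i₀ := by simpa [hw] using hi₀
  set z : V → ℝ := M *ᵥ x + x with hz
  have hzpos (i : V) : 0 < z i :=
    add_pos_of_nonneg_of_pos (Finset.sum_nonneg fun j _ => mul_nonneg (hM i j) (hx j).le) (hx i)
  have hgap (i : V) : 0 < (M *ᵥ z) i - c * z i := by
    have hsplit : (M *ᵥ z) i - c * z i = (M *ᵥ w) i + w i := by
      simp only [hz, hw, Matrix.mulVec_add, Matrix.mulVec_sub, Matrix.mulVec_smul, Pi.add_apply,
        Pi.sub_apply, Pi.smul_apply, smul_eq_mul]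
      ring
    have hMw : ∀ j ∈ Finset.univ, 0 ≤ M i j * w j := fun j _ => mul_nonneg (hM i j) (hw0 j)
    rw [hsplit]
    rcases eq_or_ne i i₀ with rfl | hne
    · exact add_pos_of_nonneg_of_pos (Finset.sum_nonneg hMw) hwpos
    · exact add_pos_of_pos_of_nonneg (Finset.sum_pos' hMw
        ⟨i₀, Finset.mem_univ _, mul_pos (hpos i i₀ hne) hwpos⟩) (hw0 i)
  obtain ⟨i, hi⟩ := Finite.exists_min fun i => ((M *ᵥ z) i - c * z i) / z i
  set ε := ((M *ᵥ z) i - c * z i) / z i with hε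
  have hεpos : 0 < ε := div_pos (hgap i) (hzpos i)
  have hle : c + ε ≤ M.realSpectralRadius := by
    refine le_realSpectralRadius hM hzpos (by positivity) fun j => ?_
    have := (le_div_iff₀ (hzpos j)).1 (hi j)
    linarith
  linarith

end Matrix

end PerronBounds

namespace Digraph

variable {V : Type*}

/-! ### Elementary distance estimates -/

section Dist

variable {G : Digraph V} {u v w : V}

theorem IsStronglyConnected.hasWalk_dist (h : G.IsStronglyConnected) (u v : V) :
    G.HasWalk (G.dist u v) u v :=
  Nat.sInf_mem (s := {l : ℕ | G.HasWalk l u v}) (h u v)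

theorem dist_le_of_hasWalk {l : ℕ} (h : G.HasWalk l u v) : G.dist u v ≤ l :=
  Nat.sInf_le h

theorem dist_self : G.dist u u = 0 :=
  Nat.le_zero.1 (dist_le_of_hasWalk (l := 0) rfl)

theorem dist_le_one (h : G.Adj u v) : G.dist u v ≤ 1 :=
  dist_le_of_hasWalk ⟨v, h, rfl⟩

theorem dist_le_two (h : G.Adj u w) (h' : G.Adj w v) : G.dist u v ≤ 2 :=
  dist_le_of_hasWalk ⟨w, h, v, h', rfl⟩

theorem IsStronglyConnected.one_le_dist (h : G.IsStronglyConnected) (huv : u ≠ v) :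
    1 ≤ G.dist u v := by
  have hw := h.hasWalk_dist u v
  by_contra! hlt
  rw [Nat.lt_one_iff.1 hlt] at hw
  exact huv hw

theorem IsStronglyConnected.two_le_dist (h : G.IsStronglyConnected) (huv : u ≠ v)
    (hadj : ¬ G.Adj u v) : 2 ≤ G.dist u v := by
  have hw := h.hasWalk_dist u v
  have h1 := h.one_le_dist huv
  by_contra! hlt
  have : G.dist u v = 1 := by omega
  rw [this] at hw
  obtain ⟨x, hx, rfl⟩ := hw
  exact hadj hx

end Dist

/-! ### Digraphs missing exactly the arcs from `A` to `B` -/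

section Split

variable [DecidableEq V]

/-- `G` has all arcs between distinct vertices except those from `A` to `B`. -/
def IsSplit (G : Digraph V) (A B : Finset V) : Prop :=
  ∀ u v : V, G.Adj u v ↔ u ≠ v ∧ ¬ (u ∈ A ∧ v ∈ B)

/-- The distance function of a digraph that has all arcs except those from `A` to `B`. -/
def splitDist (A B : Finset V) (u v : V) : ℕ :=
  if u = v then 0 else if u ∈ A ∧ v ∈ B then 2 else 1

variable {G : Digraph V} {A B : Finset V}

theorem IsStronglyConnected.splitDist_le_dist (h : G.IsStronglyConnected)
    (hAB : ∀ u ∈ A, ∀ v ∈ B, ¬ G.Adj u v) (u v : V) : splitDist A B u v ≤ G.dist u v := by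
  unfold splitDist
  split_ifs with h1 h2
  · exact Nat.zero_le _
  · exact h.two_le_dist h1 (hAB u h2.1 v h2.2)
  · exact h.one_le_dist h1

theorem IsSplit.isStronglyConnected (h : G.IsSplit A B) {s : V} (hsA : s ∉ A) (hsB : s ∉ B) :
    G.IsStronglyConnected := by
  have key (u v : V) (huv : u ≠ v) (hns : ¬ (u ∈ A ∧ v ∈ B)) : G.HasWalk 1 u v :=
    ⟨v, (h u v).2 ⟨huv, hns⟩, rfl⟩
  intro u v
  by_cases huv : u = v
  · exact ⟨0, huv⟩
  by_cases hns : u ∈ A ∧ v ∈ B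
  · refine ⟨2, s, (h u s).2 ⟨?_, fun hh => hsB hh.2⟩, key s v ?_ fun hh => hsA hh.1⟩
    · rintro rfl
      exact hsA hns.1
    · rintro rfl
      exact hsB hns.2
  · exact ⟨1, key u v huv hns⟩

/-- A vertex `s` outside `A ∪ B` is joined both ways to all others, so it gives a path of length 2
from `A` to `B`. -/
theorem IsSplit.dist_eq (h : G.IsSplit A B) {s : V} (hsA : s ∉ A) (hsB : s ∉ B) (u v : V) :
    G.dist u v = splitDist A B u v := by
  refine le_antisymm ?_ ((h.isStronglyConnected hsA hsB).splitDist_le_dist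
    (fun u hu v hv hadj => ((h u v).1 hadj).2 ⟨hu, hv⟩) u v)
  unfold splitDist
  split_ifs with h1 h2
  · exact h1 ▸ dist_self.le
  · refine dist_le_two (w := s) ((h u s).2 ⟨?_, fun hh => hsB hh.2⟩)
      ((h s v).2 ⟨?_, fun hh => hsA hh.1⟩)
    · rintro rfl
      exact hsA h2.1
    · rintro rfl
      exact hsB h2.2
  · exact dist_le_one ((h u v).2 ⟨h1, h2⟩)

theorem IsStronglyConnected.isSplit_of_dist_eq (h : G.IsStronglyConnected) (hs : G.IsSimple)
    (hd : ∀ u v, G.dist u v = splitDist A B u v) : G.IsSplit A B := by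
  intro u v
  rcases eq_or_ne u v with rfl | huv
  · simp [hs u]
  · have hduv := hd u v
    rw [splitDist, if_neg huv] at hduv
    refine ⟨fun hadj => ⟨huv, fun hns => ?_⟩, fun hh => ?_⟩
    · rw [if_pos hns] at hduv
      have := dist_le_one hadj
      omega
    · rw [if_neg hh.2] at hduv
      by_contra hadj
      have := h.two_le_dist huv hadj
      omega

theorem sum_splitDist_mul [Fintype V] (hdisj : Disjoint A B) (f : V → ℝ) (u : V) :
    ∑ v, (splitDist A B u v : ℝ) * f v =
      ∑ v, f v - f u + if u ∈ A then ∑ v ∈ B, f v else 0 := by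
  -- `splitDist` is 1, minus 1 on the diagonal, plus 1 on `A × B`; disjointness keeps the two
  -- corrections apart.
  have key (v : V) : (splitDist A B u v : ℝ) * f v =
      f v - (if u = v then f v else 0) + if u ∈ A then (if v ∈ B then f v else 0) else 0 := by
    unfold splitDist
    by_cases h1 : u = v
    · subst h1
      by_cases hA : u ∈ A
      · simp [hA, Finset.disjoint_left.1 hdisj hA]
      · simp [hA]
    · by_cases hA : u ∈ A
      · by_cases hB : v ∈ B
        · simp [h1, hA, hB]
          ring
        · simp [h1, hA, hB]
      · simp [h1, hA]
  simp only [key, Finset.sum_add_distrib, Finset.sum_sub_distrib]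
  split_ifs <;> simp

end Split

/-! ### The test vector and its image under `D_α` -/

section Weight

variable [DecidableEq V]

/-- The Perron vector of a digraph that has all arcs except those from `A` to `B`. -/
def splitWeight (α t : ℝ) (A B : Finset V) (v : V) : ℝ :=
  if v ∈ A then t + (1 - α) * B.card else t - α * B.card

variable [Fintype V] {A B : Finset V}

theorem sum_splitWeight (α t : ℝ) :
    ∑ v, splitWeight α t A B v = Fintype.card V * (t - α * B.card) + A.card * B.card := by
  have key (v : V) : splitWeight α t A B v =
      (t - α * B.card) + if v ∈ A then (B.card : ℝ) else 0 := by
    unfold splitWeight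
    split_ifs <;> ring
  simp only [key, Finset.sum_add_distrib, Finset.sum_ite_mem, Finset.univ_inter,
    Finset.sum_const, Finset.card_univ, nsmul_eq_mul]

omit [Fintype V] in
theorem sum_splitWeight_right (hdisj : Disjoint A B) (α t : ℝ) :
    ∑ v ∈ B, splitWeight α t A B v = B.card * (t - α * B.card) := by
  have key : ∀ v ∈ B, splitWeight α t A B v = t - α * B.card := fun v hv =>
    if_neg (Finset.disjoint_right.1 hdisj hv)
  rw [Finset.sum_congr rfl key, Finset.sum_const, nsmul_eq_mul]

theorem alphaDistMatrix_mulVec (G : Digraph V) (α : ℝ) (f : V → ℝ) (u : V) :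
    (G.alphaDistMatrix α).mulVec f u =
      α * (∑ v, (G.dist u v : ℝ)) * f u + (1 - α) * ∑ v, (G.dist u v : ℝ) * f v := by
  simp only [alphaDistMatrix, Matrix.add_mulVec, Matrix.smul_mulVec, Pi.add_apply, Pi.smul_apply,
    Matrix.mulVec_diagonal, smul_eq_mul, transmission]
  simp only [distMatrix, Matrix.mulVec, dotProduct, Matrix.of_apply]
  ring

/-- Eigenvalue term, a defect independent of `u` that vanishes when `t` is a root of the quadratic,
and the contribution of the excess distances. The ratio `t + (1 - α)|B| : t - α|B|` of the weights
is what makes the defect the same on and off `A`. -/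
theorem alphaDistMatrix_mulVec_splitWeight (G : Digraph V) (hdisj : Disjoint A B) (α t : ℝ)
    (u : V) :
    (G.alphaDistMatrix α).mulVec (splitWeight α t A B) u =
      (α * Fintype.card V - 1 + t) * splitWeight α t A B u
        - ((t - α * B.card) * (t - (1 - α) * Fintype.card V) - (1 - α) * B.card * A.card)
        + ∑ v, ((G.dist u v : ℝ) - splitDist A B u v) *
          (α * splitWeight α t A B u + (1 - α) * splitWeight α t A B v) := by
  set w := splitWeight α t A B with hw
  have h1 := sum_splitDist_mul hdisj (fun _ => 1) u
  have h2 := sum_splitDist_mul hdisj w u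
  rw [hw, sum_splitWeight, sum_splitWeight_right hdisj, ← hw] at h2
  have h3 : ∑ v, ((G.dist u v : ℝ) - splitDist A B u v) * (α * w u + (1 - α) * w v) =
      α * (∑ v, (G.dist u v : ℝ)) * w u + (1 - α) * ∑ v, (G.dist u v : ℝ) * w v
      - (α * w u * ∑ v, (splitDist A B u v : ℝ) * 1
        + (1 - α) * ∑ v, (splitDist A B u v : ℝ) * w v) := by
    simp only [Finset.mul_sum, Finset.sum_mul, ← Finset.sum_add_distrib,
      ← Finset.sum_sub_distrib]
    exact Finset.sum_congr rfl fun v _ => by ring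
  rw [alphaDistMatrix_mulVec, h3, h1, h2]
  by_cases hA : u ∈ A
  · have hwu : w u = t + (1 - α) * B.card := if_pos hA
    simp only [hA, if_true, hwu, Finset.sum_const, Finset.card_univ, nsmul_eq_mul]
    ring
  · have hwu : w u = t - α * B.card := if_neg hA
    simp only [hA, if_false, hwu, Finset.sum_const, Finset.card_univ, nsmul_eq_mul]
    ring

end Weight

/-! ### Spectral radius of split digraphs and the lower bound for `G` -/

section Radius

variable [Fintype V] [DecidableEq V] {G : Digraph V} {A B : Finset V} {α t : ℝ}

theorem alphaDistMatrix_nonneg (hα0 : 0 ≤ α) (hα1 : α ≤ 1) (u v : V) :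
    0 ≤ G.alphaDistMatrix α u v := by
  have h : 0 ≤ G.transmission u := Finset.sum_nonneg fun v _ => Nat.cast_nonneg _
  have h1 : 0 ≤ 1 - α := sub_nonneg.2 hα1
  simp only [alphaDistMatrix, distMatrix, Matrix.add_apply, Matrix.smul_apply, smul_eq_mul,
    Matrix.diagonal_apply, Matrix.of_apply]
  refine add_nonneg (mul_nonneg hα0 ?_) (mul_nonneg h1 (Nat.cast_nonneg _))
  split_ifs
  · exact h
  · exact le_rfl

theorem IsStronglyConnected.alphaDistMatrix_pos (h : G.IsStronglyConnected) (hα1 : α < 1)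
    {u v : V} (huv : u ≠ v) : 0 < G.alphaDistMatrix α u v := by
  have h1 : 0 < 1 - α := sub_pos.2 hα1
  have h2 : 0 < G.dist u v := h.one_le_dist huv
  simp only [alphaDistMatrix, distMatrix, Matrix.add_apply, Matrix.smul_apply, smul_eq_mul,
    Matrix.diagonal_apply, Matrix.of_apply, if_neg huv]
  rw [mul_zero, zero_add]
  positivity

theorem splitWeight_pos (hm : α * B.card < t) (ht : (1 - α) * Fintype.card V < t) (hα1 : α ≤ 1)
    (v : V) : 0 < splitWeight α t A B v := by
  have h1 : 0 ≤ 1 - α := sub_nonneg.2 hα1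
  have h2 : 0 < t := lt_of_le_of_lt (by positivity) ht
  unfold splitWeight
  split_ifs
  · positivity
  · linarith

omit [DecidableEq V] in
theorem alpha_mul_card_sub_one_add_nonneg [Nonempty V] (ht : (1 - α) * Fintype.card V < t) :
    0 ≤ α * Fintype.card V - 1 + t := by
  have : (1 : ℝ) ≤ Fintype.card V := by exact_mod_cast Fintype.card_pos
  linarith

theorem IsSplit.alphaSpectralRadius_eq (h : G.IsSplit A B) {s : V} (hsA : s ∉ A) (hsB : s ∉ B)
    (hdisj : Disjoint A B) (hα0 : 0 ≤ α) (hα1 : α ≤ 1) (hm : α * B.card < t) (ht : (1 - α) * Fintype.card V < t)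
    (hroot : (t - α * B.card) * (t - (1 - α) * Fintype.card V) = (1 - α) * B.card * A.card) :
    G.alphaSpectralRadius α = α * Fintype.card V - 1 + t := by
  have : Nonempty V := ⟨s⟩
  have hx := splitWeight_pos (A := A) hm ht hα1
  have heq (u : V) : (G.alphaDistMatrix α).mulVec (splitWeight α t A B) u =
      (α * Fintype.card V - 1 + t) * splitWeight α t A B u := by
    rw [alphaDistMatrix_mulVec_splitWeight G hdisj, hroot]
    simp [h.dist_eq hsA hsB]
  have hc := alpha_mul_card_sub_one_add_nonneg ht
  exact le_antisymm
    (Matrix.realSpectralRadius_le (alphaDistMatrix_nonneg hα0 hα1) hx fun u => (heq u).le)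
    (Matrix.le_realSpectralRadius (alphaDistMatrix_nonneg hα0 hα1) hx hc fun u => (heq u).ge)

theorem IsStronglyConnected.le_alphaSpectralRadius_and_isSplit (h : G.IsStronglyConnected)
    (hs : G.IsSimple) [Nonempty V] (hAB : ∀ u ∈ A, ∀ v ∈ B, ¬ G.Adj u v)
    (hdisj : Disjoint A B) (hα0 : 0 ≤ α) (hα1 : α < 1) (hm : α * B.card < t) (ht : (1 - α) * Fintype.card V < t)
    (hroot : (t - α * B.card) * (t - (1 - α) * Fintype.card V) = (1 - α) * B.card * A.card) :
    α * Fintype.card V - 1 + t ≤ G.alphaSpectralRadius α ∧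
      (G.alphaSpectralRadius α = α * Fintype.card V - 1 + t → G.IsSplit A B) := by
  have hx := splitWeight_pos (A := A) hm ht hα1.le
  have hterm (u v : V) : 0 ≤ ((G.dist u v : ℝ) - splitDist A B u v) *
      (α * splitWeight α t A B u + (1 - α) * splitWeight α t A B v) := by
    have h1 : 0 ≤ 1 - α := sub_nonneg.2 hα1.le
    have h2 := (hx u).le
    have h3 := (hx v).le
    refine mul_nonneg (sub_nonneg.2 ?_) (by positivity)
    exact_mod_cast h.splitDist_le_dist hAB u v
  have heq (u : V) := alphaDistMatrix_mulVec_splitWeight G hdisj α t u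
  simp only [hroot, sub_self, sub_zero] at heq
  have hle (u : V) : (α * Fintype.card V - 1 + t) * splitWeight α t A B u ≤
      (G.alphaDistMatrix α).mulVec (splitWeight α t A B) u := by
    rw [heq]
    exact le_add_of_nonneg_right (Finset.sum_nonneg fun v _ => hterm u v)
  have hc := alpha_mul_card_sub_one_add_nonneg ht
  refine ⟨Matrix.le_realSpectralRadius (alphaDistMatrix_nonneg hα0 hα1.le) hx hc hle,
    fun hρ => h.isSplit_of_dist_eq hs fun u v => ?_⟩
  by_contra hne
  have hlt : (splitDist A B u v : ℝ) < G.dist u v := by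
    exact_mod_cast lt_of_le_of_ne (h.splitDist_le_dist hAB u v) (Ne.symm hne)
  -- One distance exceeding `splitDist` makes row `u` strict, which contradicts equality.
  refine (Matrix.lt_realSpectralRadius (alphaDistMatrix_nonneg hα0 hα1.le)
    (fun _ _ huv => h.alphaDistMatrix_pos hα1 huv) hx hc hle (i₀ := u) ?_).ne' hρ
  rw [heq]
  refine lt_add_of_pos_right _ (Finset.sum_pos' (fun v _ => hterm u v) ⟨v, Finset.mem_univ _, ?_⟩)
  exact mul_pos (sub_pos.2 hlt) (add_pos_of_nonneg_of_pos (mul_nonneg hα0 (hx u).le)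
    (mul_pos (sub_pos.2 hα1) (hx v)))

end Radius

end Digraph

namespace Digraph

/-! ### Identification with `K(n,k,m)` and separation by a minimum cut -/

section Extremal

variable {V : Type*} [Fintype V] [DecidableEq V] {G : Digraph V} {n k m : ℕ}

omit [Fintype V] in
theorem IsIsomorphic.exists_isSplit (h : G.IsIsomorphic (extremal n k m)) :
    ∃ A B : Finset V, Disjoint A B ∧ A.card = n - k - m ∧ B.card = m ∧ G.IsSplit A B ∧
      (0 < k → ∃ s, s ∉ A ∧ s ∉ B) := by
  obtain ⟨e⟩ := h
  have hmemA (x : V) : x ∈ Finset.univ.image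
      (fun i : Fin (n - k - m) => e.symm (Sum.inr (Sum.inl i))) ↔
      ∃ i, Sum.inr (Sum.inl i) = e x := by
    simp only [Finset.mem_image, Finset.mem_univ, true_and]
    exact exists_congr fun i => e.toEquiv.symm_apply_eq
  have hmemB (x : V) : x ∈ Finset.univ.image
      (fun i : Fin m => e.symm (Sum.inr (Sum.inr i))) ↔ ∃ i, Sum.inr (Sum.inr i) = e x := by
    simp only [Finset.mem_image, Finset.mem_univ, true_and]
    exact exists_congr fun i => e.toEquiv.symm_apply_eq
  refine ⟨Finset.univ.image fun i => e.symm (Sum.inr (Sum.inl i)),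
    Finset.univ.image fun i => e.symm (Sum.inr (Sum.inr i)), ?_, ?_, ?_, ?_, ?_⟩
  · refine Finset.disjoint_left.2 fun x hA hB => ?_
    obtain ⟨i, hi⟩ := (hmemA x).1 hA
    obtain ⟨j, hj⟩ := (hmemB x).1 hB
    simp [← hi] at hj
  · rw [Finset.card_image_of_injective _ fun i j hij => by simpa using hij]
    simp
  · rw [Finset.card_image_of_injective _ fun i j hij => by simpa using hij]
    simp
  · intro u v
    rw [hmemA, hmemB, ← e.map_rel_iff, ← e.injective.ne_iff]
    generalize e u = x
    generalize e v = y
    rcases x with x | x | x <;> rcases y with y | y | y <;>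
      simp [extremal, join, disjointUnion, simpleComplete, thirdToSecond]
  · intro hk
    refine ⟨e.symm (Sum.inl ⟨0, hk⟩), ?_, ?_⟩
    · rw [hmemA]
      simp
    · rw [hmemB]
      simp

theorem IsSplit.isIsomorphic_extremal {A B : Finset V} (h : G.IsSplit A B) (hdisj : Disjoint A B)
    (hA : A.card = n - k - m) (hB : B.card = m) (hV : Fintype.card V = n) (hkm : k + m ≤ n) :
    G.IsIsomorphic (extremal n k m) := by
  have hS : ((A ∪ B)ᶜ).card = k := by
    rw [Finset.card_compl, Finset.card_union_of_disjoint hdisj]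
    omega
  let eS := ((A ∪ B)ᶜ).equivFinOfCardEq hS
  let eA := A.equivFinOfCardEq hA
  let eB := B.equivFinOfCardEq hB
  let f : Fin k ⊕ (Fin (n - k - m) ⊕ Fin m) → V :=
    Sum.elim (fun i => eS.symm i) (Sum.elim (fun i => eA.symm i) fun i => eB.symm i)
  have hfS (i : Fin k) : f (Sum.inl i) ∉ A ∧ f (Sum.inl i) ∉ B := by
    have h : f (Sum.inl i) ∈ (A ∪ B)ᶜ := (eS.symm i).2
    rwa [Finset.mem_compl, Finset.mem_union, not_or] at h
  have hfA (i : Fin (n - k - m)) : f (Sum.inr (Sum.inl i)) ∈ A := (eA.symm i).2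
  have hfB (i : Fin m) : f (Sum.inr (Sum.inr i)) ∈ B := (eB.symm i).2
  have hfA' (i : Fin (n - k - m)) : f (Sum.inr (Sum.inl i)) ∉ B :=
    Finset.disjoint_left.1 hdisj (hfA i)
  have hfB' (i : Fin m) : f (Sum.inr (Sum.inr i)) ∉ A :=
    Finset.disjoint_right.1 hdisj (hfB i)
  have hinj : Function.Injective f := by
    rintro (i | i | i) (j | j | j) hij
    · exact congrArg _ (eS.symm.injective (Subtype.ext hij))
    · exact absurd (hij ▸ hfA j) (hfS i).1
    · exact absurd (hij ▸ hfB j) (hfS i).2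
    · exact absurd (hij ▸ hfA i) (hfS j).1
    · exact congrArg _ (congrArg _ (eA.symm.injective (Subtype.ext hij)))
    · exact absurd (hij ▸ hfB j) (hfA' i)
    · exact absurd (hij ▸ hfB i) (hfS j).2
    · exact absurd (hij ▸ hfA j) (hfB' i)
    · exact congrArg _ (congrArg _ (eB.symm.injective (Subtype.ext hij)))
  have hbij : Function.Bijective f := by
    refine (Fintype.bijective_iff_injective_and_card f).2 ⟨hinj, ?_⟩
    simp only [Fintype.card_sum, Fintype.card_fin]
    omega
  refine ⟨RelIso.symm ⟨Equiv.ofBijective f hbij, fun {x y} => ?_⟩⟩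
  rw [Equiv.ofBijective_apply, Equiv.ofBijective_apply, h, hinj.ne_iff]
  rcases x with x | x | x <;> rcases y with y | y | y <;>
    simp [extremal, join, disjointUnion, simpleComplete, thirdToSecond, hfS, hfA, hfB, hfA', hfB']

theorem exists_separation_of_not_isStronglyConnected {S : Finset V}
    (h : ¬ (G.deleteVerts S).IsStronglyConnected) :
    ∃ A B : Finset V, Disjoint A B ∧ (A ∪ B)ᶜ = S ∧ A.Nonempty ∧ B.Nonempty ∧
      ∀ u ∈ A, ∀ v ∈ B, ¬ G.Adj u v := by
  classical
  unfold IsStronglyConnected at h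
  push Not at h
  obtain ⟨u, v, huv⟩ := h
  -- `B` consists of the vertices that reach `v` outside `S`; an arc from `A` into `B` would extend
  -- such a walk.
  set P : V → Prop := fun x => ∃ hx : x ∉ S, ∃ l, (G.deleteVerts S).HasWalk l ⟨x, hx⟩ v
  refine ⟨Finset.univ.filter fun x => x ∉ S ∧ ¬ P x, Finset.univ.filter P, ?_, ?_,
    ⟨u, ?_⟩, ⟨v, ?_⟩, ?_⟩
  · exact Finset.disjoint_left.2 fun x hx hx' =>
      (Finset.mem_filter.1 hx).2.2 (Finset.mem_filter.1 hx').2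
  · ext x
    have : P x → x ∉ S := fun hx => hx.1
    simp only [Finset.mem_compl, Finset.mem_union, Finset.mem_filter, Finset.mem_univ, true_and]
    tauto
  · simp only [Finset.mem_filter, Finset.mem_univ, true_and]
    exact ⟨u.2, fun ⟨_, l, hl⟩ => huv l hl⟩
  · simp only [Finset.mem_filter, Finset.mem_univ, true_and]
    exact ⟨v.2, 0, rfl⟩
  · intro a ha b hb hab
    simp only [Finset.mem_filter, Finset.mem_univ, true_and] at ha hb
    obtain ⟨hbS, l, hl⟩ := hb
    exact ha.2 ⟨ha.1, l + 1, ⟨b, hbS⟩, hab, hl⟩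

theorem exists_separation (hk : 0 < k) (hkV : k + 2 ≤ Fintype.card V)
    (hconn : G.vertexConnectivity = k) :
    ∃ A B : Finset V, Disjoint A B ∧ A.card + B.card + k = Fintype.card V ∧ 0 < A.card ∧
      0 < B.card ∧ ∀ u ∈ A, ∀ v ∈ B, ¬ G.Adj u v := by
  have hpos : 0 < G.vertexConnectivity := hconn ▸ hk
  -- The infimum of the empty set is 0, so positive connectivity ensures that a minimum is attained.
  obtain ⟨S, hS, hcut⟩ := Nat.sInf_mem (Nat.nonempty_of_pos_sInf hpos)
  replace hS : S.card = k := hS.trans hconn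
  obtain ⟨A, B, hdisj, hAB, hA, hB, hadj⟩ :=
    exists_separation_of_not_isStronglyConnected (hcut.resolve_right (by omega))
  refine ⟨A, B, hdisj, ?_, hA.card_pos, hB.card_pos, hadj⟩
  rw [← hAB, Finset.card_compl, Finset.card_union_of_disjoint hdisj] at hS
  omega

end Extremal

/-! ### Minimizing the root of the quadratic -/

section SplitRoot

/-- The larger root `t` of `(t - α m) (t - (1 - α) N) = (1 - α) m a`. -/
noncomputable def splitRoot (α N a m : ℝ) : ℝ :=
  (α * m + (1 - α) * N + √((α * m - (1 - α) * N) ^ 2 + 4 * ((1 - α) * m * a))) / 2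

variable {α N a m a' : ℝ}

theorem splitRoot_spec (hα : α < 1) (ha : 0 < a) (hm : 0 < m) :
    α * m < splitRoot α N a m ∧ (1 - α) * N < splitRoot α N a m ∧
      (splitRoot α N a m - α * m) * (splitRoot α N a m - (1 - α) * N) = (1 - α) * m * a := by
  have hpos : 0 < (1 - α) * m * a := mul_pos (mul_pos (sub_pos.2 hα) hm) ha
  have hsq := Real.sq_sqrt
    (show 0 ≤ (α * m - (1 - α) * N) ^ 2 + 4 * ((1 - α) * m * a) by positivity)
  have habs : |α * m - (1 - α) * N| < √((α * m - (1 - α) * N) ^ 2 + 4 * ((1 - α) * m * a)) :=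
    Real.lt_sqrt_of_sq_lt (by rw [sq_abs]; linarith)
  obtain ⟨h1, h2⟩ := abs_lt.1 habs
  unfold splitRoot
  refine ⟨by linarith, by linarith, ?_⟩
  linear_combination hsq / 4

/-- Since `m * a = a' + (m - 1) * (a - 1)`, the quadratic of `(a, m)` is nonpositive at the root
`t'` of `(a', 1)`, so its larger root `t` is at least `t'`. Equality annihilates both nonnegative
terms `e1` and `e2`. -/
theorem splitRoot_one_le (hα0 : 0 ≤ α) (hα1 : α < 1) (ha : 1 ≤ a) (hm : 1 ≤ m)
    (haa : a' = a + m - 1) :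
    splitRoot α N a' 1 ≤ splitRoot α N a m ∧
      (splitRoot α N a m = splitRoot α N a' 1 → m = 1 ∨ α = 0 ∧ a = 1) := by
  obtain ⟨h1, h2, h3⟩ := splitRoot_spec (N := N) hα1 (by linarith : 0 < a) (by linarith : 0 < m)
  obtain ⟨h1', h2', h3'⟩ := splitRoot_spec (N := N) hα1 (by linarith : 0 < a') one_pos
  set t := splitRoot α N a m
  set t' := splitRoot α N a' 1
  have hβ : 0 < 1 - α := sub_pos.2 hα1
  have e1 : 0 ≤ (1 - α) * ((m - 1) * (a - 1)) :=
    mul_nonneg hβ.le (mul_nonneg (by linarith) (by linarith))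
  have e2 : 0 ≤ α * (m - 1) * (t' - (1 - α) * N) :=
    mul_nonneg (mul_nonneg hα0 (by linarith)) (by linarith)
  have hdiff : (t' - α * m) * (t' - (1 - α) * N) = (1 - α) * m * a
      - (1 - α) * ((m - 1) * (a - 1)) - α * (m - 1) * (t' - (1 - α) * N) := by
    subst haa
    linear_combination h3'
  refine ⟨?_, fun heq => ?_⟩
  · by_contra! hlt
    -- Both factors are positive at `t` and increasing, so the product grows beyond `t`.
    have : (t - α * m) * (t - (1 - α) * N) < (t' - α * m) * (t' - (1 - α) * N) :=
      mul_lt_mul'' (by linarith) (by linarith) (by linarith) (by linarith)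
    linarith
  · rw [← heq] at hdiff e2 h2'
    have z1 : (1 - α) * ((m - 1) * (a - 1)) = 0 := by linarith
    have z2 : α * (m - 1) * (t - (1 - α) * N) = 0 := by linarith
    rcases eq_or_ne m 1 with hm1 | hm1
    · exact Or.inl hm1
    · have hm1' := sub_ne_zero.2 hm1
      have hne := (sub_pos.2 h2).ne'
      refine Or.inr ⟨?_, ?_⟩
      · simpa [hm1', hne] using z2
      · simpa [hβ.ne', hm1', sub_eq_zero] using z1

/-- At `α = 0` only the product `m * a` matters, whence the second extremal digraph. -/
theorem splitRoot_zero_comm : splitRoot 0 N a m = splitRoot 0 N m a := by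
  simp [splitRoot, mul_comm]

end SplitRoot

/-! ### Assembly of the bound and its equality cases -/

section Main

variable {V : Type*} [Fintype V] [DecidableEq V] {G : Digraph V} {n k m : ℕ} {α : ℝ}

theorem IsIsomorphic.alphaSpectralRadius_eq (h : G.IsIsomorphic (extremal n k m))
    (hV : Fintype.card V = n) (hk : 0 < k) (hm : 0 < m) (hkm : k + m < n) (hα0 : 0 ≤ α)
    (hα1 : α < 1) :
    G.alphaSpectralRadius α = α * n - 1 + splitRoot α n ((n - k - m : ℕ) : ℝ) m := by
  obtain ⟨A, B, hdisj, hA, hB, hsplit, hs⟩ := h.exists_isSplit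
  obtain ⟨s, hsA, hsB⟩ := hs hk
  obtain ⟨h1, h2, h3⟩ := splitRoot_spec (α := α) (N := n) hα1
    (a := ((n - k - m : ℕ) : ℝ)) (m := m) (by exact_mod_cast (by omega)) (by exact_mod_cast hm)
  subst hV
  rw [← hA, ← hB] at h1 h2 h3 ⊢
  exact hsplit.alphaSpectralRadius_eq hsA hsB hdisj hα0 hα1.le h1 h2 h3

theorem isIsomorphic_refl {W : Type*} (H : Digraph W) : H.IsIsomorphic H :=
  ⟨RelIso.refl _⟩

theorem IsStronglyConnected.alphaSpectralRadius_lower_bound (h : G.IsStronglyConnected)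
    (hs : G.IsSimple) (hV : Fintype.card V = n) (hk : 0 < k) (hkn : k + 2 ≤ n)
    (hconn : G.vertexConnectivity = k) (hα0 : 0 ≤ α) (hα1 : α < 1) :
    α * n - 1 + splitRoot α n (n - k - 1) 1 ≤ G.alphaSpectralRadius α ∧
      (G.alphaSpectralRadius α = α * n - 1 + splitRoot α n (n - k - 1) 1 →
        G.IsIsomorphic (extremal n k 1) ∨
          α = 0 ∧ G.IsIsomorphic (extremal n k (n - k - 1))) := by
  obtain ⟨A, B, hdisj, hcard, hA, hB, hadj⟩ := exists_separation hk (by omega) hconn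
  have : Nonempty V := Fintype.card_pos_iff.1 (by omega)
  have hA1 : (1 : ℝ) ≤ A.card := by exact_mod_cast hA
  have hB1 : (1 : ℝ) ≤ B.card := by exact_mod_cast hB
  obtain ⟨h1, h2, h3⟩ := splitRoot_spec (α := α) (N := Fintype.card V) hα1
    (a := A.card) (m := B.card) (by linarith) (by linarith)
  obtain ⟨hle, heq⟩ := h.le_alphaSpectralRadius_and_isSplit hs hadj hdisj hα0 hα1 h1 h2 h3
  have haa : (n : ℝ) - k - 1 = A.card + B.card - 1 := by
    have : (A.card : ℝ) + B.card + k = n := by exact_mod_cast hcard.trans hV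
    linarith
  rw [hV] at hle heq
  obtain ⟨hroot, hroot_eq⟩ := splitRoot_one_le (N := n) hα0 hα1 hA1 hB1 haa
  refine ⟨by linarith, fun hρ => ?_⟩
  have hsplit := heq (by linarith)
  rcases hroot_eq (by linarith) with hm | ⟨hα, ha⟩
  · have hm : B.card = 1 := by exact_mod_cast hm
    exact Or.inl (hsplit.isIsomorphic_extremal hdisj (by omega) hm hV (by omega))
  · have ha : A.card = 1 := by exact_mod_cast ha
    exact Or.inr ⟨hα, hsplit.isIsomorphic_extremal hdisj (by omega) (by omega) hV (by omega)⟩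

theorem alphaSpectralRadius_extremal_one (hk : 0 < k) (hkn : k + 2 ≤ n) (hα0 : 0 ≤ α)
    (hα1 : α < 1) :
    (extremal n k 1).alphaSpectralRadius α = α * n - 1 + splitRoot α n (n - k - 1) 1 := by
  have hcard : Fintype.card (Fin k ⊕ (Fin (n - k - 1) ⊕ Fin 1)) = n := by
    simp only [Fintype.card_sum, Fintype.card_fin]
    omega
  rw [(isIsomorphic_refl (extremal n k 1)).alphaSpectralRadius_eq hcard hk one_pos (by omega)
    hα0 hα1, Nat.cast_sub (by omega), Nat.cast_sub (by omega), Nat.cast_one]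

end Main

end Digraph

open Digraph in
theorem theorem4p5 {V : Type*} [Fintype V] [DecidableEq V] (n k : ℕ)
    (hk : 1 ≤ k) (hkn : k + 2 ≤ n)
    (G : Digraph V) (hsimple : G.IsSimple) (hstrong : G.IsStronglyConnected)
    (horder : Fintype.card V = n) (hconn : G.vertexConnectivity = k) :
    (((n : ℝ) - 2 + √((n : ℝ) ^ 2 + 4 * n - 4 * k - 4)) / 2 ≤ G.alphaSpectralRadius 0 ∧
      (G.alphaSpectralRadius 0 = ((n : ℝ) - 2 + √((n : ℝ) ^ 2 + 4 * n - 4 * k - 4)) / 2 ↔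
        G.IsIsomorphic (Digraph.extremal n k 1) ∨
          G.IsIsomorphic (Digraph.extremal n k (n - k - 1)))) ∧
    (∀ α : ℝ, 0 < α → α ≤ 4 / 5 →
      (Digraph.extremal n k 1).alphaSpectralRadius α =
        ((n : ℝ) - 2 + α + α * n +
          √((1 - α) ^ 2 * (n : ℝ) ^ 2 + (2 * α ^ 2 - 6 * α + 4) * n + (α ^ 2 + 4 * α - 4)
            - 4 * (1 - α) * k)) / 2 ∧
      (Digraph.extremal n k 1).alphaSpectralRadius α ≤ G.alphaSpectralRadius α ∧
      (G.alphaSpectralRadius α = (Digraph.extremal n k 1).alphaSpectralRadius α ↔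
        G.IsIsomorphic (Digraph.extremal n k 1))) := by
  have hiso {α : ℝ} (hα0 : 0 ≤ α) (hα1 : α < 1) (h : G.IsIsomorphic (extremal n k 1)) :
      G.alphaSpectralRadius α = α * n - 1 + splitRoot α n (n - k - 1) 1 := by
    rw [h.alphaSpectralRadius_eq horder hk one_pos (by omega) hα0 hα1, Nat.cast_sub (by omega),
      Nat.cast_sub (by omega), Nat.cast_one]
  constructor
  · have hval : ((n : ℝ) - 2 + √((n : ℝ) ^ 2 + 4 * n - 4 * k - 4)) / 2 =
        0 * n - 1 + splitRoot 0 n (n - k - 1) 1 := by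
      have hrad : (0 * 1 - (1 - 0) * (n : ℝ)) ^ 2 + 4 * ((1 - 0) * 1 * ((n : ℝ) - k - 1)) =
          (n : ℝ) ^ 2 + 4 * n - 4 * k - 4 := by ring
      rw [splitRoot, hrad]
      ring
    obtain ⟨hle, heq⟩ := hstrong.alphaSpectralRadius_lower_bound hsimple horder hk hkn hconn
      le_rfl one_pos
    rw [hval]
    refine ⟨hle, fun h => (heq h).imp_right And.right, ?_⟩
    rintro (h | h)
    · exact hiso le_rfl one_pos h
    · have hsub : n - k - (n - k - 1) = 1 := by omega
      rw [h.alphaSpectralRadius_eq horder hk (by omega) (by omega) le_rfl one_pos, hsub,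
        splitRoot_zero_comm, Nat.cast_sub (by omega), Nat.cast_sub (by omega), Nat.cast_one]
  · intro α hα0 hα
    have hα1 : α < 1 := by linarith
    obtain ⟨hle, heq⟩ := hstrong.alphaSpectralRadius_lower_bound hsimple horder hk hkn hconn
      hα0.le hα1
    rw [alphaSpectralRadius_extremal_one hk hkn hα0.le hα1]
    refine ⟨?_, hle, fun h => (heq h).resolve_right fun h' => hα0.ne' h'.1, hiso hα0.le hα1⟩
    have hrad : (α * 1 - (1 - α) * (n : ℝ)) ^ 2 + 4 * ((1 - α) * 1 * ((n : ℝ) - k - 1)) =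
        (1 - α) ^ 2 * (n : ℝ) ^ 2 + (2 * α ^ 2 - 6 * α + 4) * n + (α ^ 2 + 4 * α - 4)
          - 4 * (1 - α) * k := by ring
    rw [splitRoot, hrad]
    ring
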